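/- Let $q=p^e$ be a prime power ($p$ prime) and $\mathbb F_q$ the field with $q$ elements. Let $V_n=(\mathbb C^{q})^{\otimes n}$ with orthonormal basis $|x\rangle$, $x\in\mathbb F_q^n$. For $a,b\in\mathbb F_q^n$ and $c\in\mathbb F_p$ let $e=\omega^cX(a)Z(b)$ be the error operator with $X(a)|x\rangle=|x+a\rangle$, $Z(b)|x\rangle=\omega^{\sum_i\mathrm{tr}(b_ix_i)}|x\rangle$, where $\omega=e^{2\pi i/p}$ and $\mathrm{tr}$ is the trace $\mathbb F_q\to\mathbb F_p$; its weight is the number of $i$ with $(a_i,b_i)\ne(0,0)$. An $[[n,k,d]]_q$ quantum code is a subspace $Q\subseteq V_n$ of dimension $q^k$ whose minimum distance is $d$: that is, $d\ge1$ is the largest integer such that $\langle u|e|v\rangle=0$ for all orthogonal $u,v\in Q$ and all error operators $e$ of weight at most $d-1$, where for $\dim Q=1$ one requires in addition that $\langle u|e|v\rangle=0$ for all $u,v\in Q$ and all error operators $e$ of weight between $1$ and $d-1$. It is called a quantum MDS code if it attains the quantum Singleton bound, $2d=n-k+2$. Let $n\le q$, $1\le k_1\le n$ and $1\le k_2\le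 n$ with $k_1+k_2\ge n$. Then: (1) there exists an $[[n,k_1+k_2-n,d]]_q$ quantum code for some $d\ge\min\{n-k_1+1,\,n-k_2+1\}$; (2) when $k_1=k_2=k$ and $k\ge\lceil n/2\rceil$, there exists a quantum MDS code with parameters $[[n,2k-n,n-k+1]]_q$. -/

import Mathlib

namespace QuantumCode

/-- The Hilbert space `V_n = ℂ^q ⊗ ⋯ ⊗ ℂ^q` (`n` factors, `q = |F|`), in coordinates with respect to
its standard orthonormal basis `|c⟩ = |c_1 ⋯ c_n⟩`, `c ∈ F^n`. -/
abbrev QSpace (F : Type*) [Fintype F] (n : ℕ) : Type _ := EuclideanSpace ℂ (Fin n → F)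

/-- The phase `∏ i, ω ^ tr (b_i x_i)`, where `ω = exp (2πi/p)` and `tr` is the trace from `F` to its
prime field. (`ZMod.stdAddChar j = exp (2πi j / p) = ω ^ j`.) -/
noncomputable def phase (p : ℕ) [Fact p.Prime] {F : Type*} [Field F] [Algebra (ZMod p) F]
    {n : ℕ} (b x : Fin n → F) : ℂ :=
  ∏ i, ZMod.stdAddChar (Algebra.trace (ZMod p) F (b i * x i))

/-- `X(a) = X(a_1) ⊗ ⋯ ⊗ X(a_n)`, that is, `X(a)|x⟩ = |x + a⟩`. -/
noncomputable def opX {F : Type*} [Field F] [Fintype F] {n : ℕ} (a : Fin n → F) :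
    QSpace F n →ₗ[ℂ] QSpace F n where
  toFun ψ := WithLp.toLp 2 fun x => ψ (x - a)
  map_add' ψ φ := by ext x; simp
  map_smul' r ψ := by ext x; simp

/-- `Z(b) = Z(b_1) ⊗ ⋯ ⊗ Z(b_n)`, that is, `Z(b)|x⟩ = (∏ i, ω ^ tr (b_i x_i)) |x⟩`. -/
noncomputable def opZ (p : ℕ) [Fact p.Prime] {F : Type*} [Field F] [Fintype F]
    [Algebra (ZMod p) F] {n : ℕ} (b : Fin n → F) : QSpace F n →ₗ[ℂ] QSpace F n where
  toFun ψ := WithLp.toLp 2 fun x => phase p b x * ψ x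
  map_add' ψ φ := by ext x; simp [mul_add]
  map_smul' r ψ := by ext x; simp [mul_left_comm]

theorem opX_single {F : Type*} [Field F] [Fintype F] [DecidableEq F] {n : ℕ} (a x : Fin n → F) :
    opX a (EuclideanSpace.single x (1 : ℂ)) = EuclideanSpace.single (x + a) 1 := by
  ext y
  simp [opX, sub_eq_iff_eq_add]

theorem opZ_single (p : ℕ) [Fact p.Prime] {F : Type*} [Field F] [Fintype F] [DecidableEq F]
    [Algebra (ZMod p) F] {n : ℕ} (b x : Fin n → F) :
    opZ p b (EuclideanSpace.single x (1 : ℂ)) = phase p b x • EuclideanSpace.single x (1 : ℂ) := by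
  ext y
  by_cases h : y = x
  · subst h; simp [opZ]
  · simp [opZ, h]

/-- The element `ω^c X(a) Z(b)` of the error group `G_n`. -/
noncomputable def errorOp {p : ℕ} [Fact p.Prime] {F : Type*} [Field F] [Fintype F]
    [Algebra (ZMod p) F] {n : ℕ} (c : ZMod p) (a b : Fin n → F) :
    QSpace F n →ₗ[ℂ] QSpace F n :=
  ZMod.stdAddChar c • (opX a ∘ₗ opZ p b)

/-- The quantum weight of `ω^c X(a) Z(b)`: the number of `i` with `(a_i, b_i) ≠ (0, 0)`. -/
def qWeight {F : Type*} [Field F] [DecidableEq F] {n : ℕ} (a b : Fin n → F) : ℕ :=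
  hammingNorm fun i => (a i, b i)

/-- `Q` detects `t` errors: `⟨u|e|v⟩ = 0` for all orthogonal `u, v ∈ Q` and all `e` in the error
group of weight at most `t`. -/
def Detects (p : ℕ) [Fact p.Prime] {F : Type*} [Field F] [Fintype F] [DecidableEq F]
    [Algebra (ZMod p) F] {n : ℕ} (Q : Submodule ℂ (QSpace F n)) (t : ℕ) : Prop :=
  ∀ u ∈ Q, ∀ v ∈ Q, inner ℂ u v = 0 → ∀ (c : ZMod p) (a b : Fin n → F),
    qWeight a b ≤ t → inner ℂ u (errorOp c a b v) = 0

/-- Purity up to weight `t`: `⟨u|e|v⟩ = 0` for all `u, v ∈ Q` and all `e` in the error group of weight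
between `1` and `t`. -/
def Pure (p : ℕ) [Fact p.Prime] {F : Type*} [Field F] [Fintype F] [DecidableEq F]
    [Algebra (ZMod p) F] {n : ℕ} (Q : Submodule ℂ (QSpace F n)) (t : ℕ) : Prop :=
  ∀ u ∈ Q, ∀ v ∈ Q, ∀ (c : ZMod p) (a b : Fin n → F),
    1 ≤ qWeight a b → qWeight a b ≤ t → inner ℂ u (errorOp c a b v) = 0

/-- `Q` has dimension `q^k` and detects `d - 1` errors, `d ≥ 1`. For a one-dimensional `Q` detection
is void, and, as usual, purity is required instead. -/
structure IsCode (p : ℕ) [Fact p.Prime] {F : Type*} [Field F] [Fintype F] [DecidableEq F]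
    [Algebra (ZMod p) F] {n : ℕ} (Q : Submodule ℂ (QSpace F n)) (k d : ℕ) : Prop where
  finrank_eq : Module.finrank ℂ Q = Fintype.card F ^ k
  one_le : 1 ≤ d
  detects : Detects p Q (d - 1)
  pure_of_finrank_eq_one : Module.finrank ℂ Q = 1 → Pure p Q (d - 1)

/-- `Q` is an `[[n, k, d]]_q` quantum code whose minimum distance is exactly `d`. -/
def HasParameters (p : ℕ) [Fact p.Prime] {F : Type*} [Field F] [Fintype F] [DecidableEq F]
    [Algebra (ZMod p) F] {n : ℕ} (Q : Submodule ℂ (QSpace F n)) (k d : ℕ) : Prop :=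
  IsGreatest {d' | IsCode p Q k d'} d

/-- `Q` is a quantum MDS code with parameters `[[n, k, d]]_q`: it attains the quantum Singleton
bound, `2d = n - k + 2`. -/
def IsQuantumMDS (p : ℕ) [Fact p.Prime] {F : Type*} [Field F] [Fintype F] [DecidableEq F]
    [Algebra (ZMod p) F] {n : ℕ} (Q : Submodule ℂ (QSpace F n)) (k d : ℕ) : Prop :=
  HasParameters p Q k d ∧ (2 * d : ℤ) = n - k + 2

end QuantumCode

/-!
The codes are CSS codes of nested Reed–Solomon codes `D = RS_{n - k₂} ≤ RS_{k₁} = C`. An error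
`X(a)Z(b)` moves the support `C` of the states off itself unless `a ∈ C`, and it commutes only up
to a nontrivial phase with some stabilizer `X(z)`, `z ∈ D`, unless `b ∈ D^⊥`. So only errors with
`a ∈ C` and `b ∈ D^⊥` have nonzero matrix elements, and apart from the scalars these have weight at
least `min (n - k₁ + 1) (n - k₂ + 1)`, because `C` and `D^⊥` are classical MDS codes. Conversely,
for a word `a` of minimum weight in `C`, the operator `X(a)` maps the state `∑_{y ∈ D} |y⟩` to a
state of the code, which is orthogonal to it if `a ∉ D`. Hence the distance is at most
`n - k₁ + 1`, and by symmetry in `k₁` and `k₂` the minimum above can be attained exactly.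
-/

namespace QuantumCode

section Phase

variable (p : ℕ) [Fact p.Prime] {F : Type*} [Field F] [Algebra (ZMod p) F] {n : ℕ}

theorem phase_eq_stdAddChar_trace_dotProduct (b x : Fin n → F) :
    phase p b x = ZMod.stdAddChar (Algebra.trace (ZMod p) F (b ⬝ᵥ x)) := by
  rw [phase, dotProduct, map_sum]
  exact (map_prod (ZMod.stdAddChar (N := p)).toMonoidHom
    (fun i => Multiplicative.ofAdd (Algebra.trace (ZMod p) F (b i * x i))) Finset.univ).symm

theorem phase_add (b x y : Fin n → F) : phase p b (x + y) = phase p b x * phase p b y := by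
  simp only [phase_eq_stdAddChar_trace_dotProduct, dotProduct_add, map_add,
    AddChar.map_add_eq_mul]

@[simp]
theorem phase_zero_left (x : Fin n → F) : phase p 0 x = 1 := by
  simp [phase]

theorem exists_mem_phase_ne_one [Finite F] {D : Submodule F (Fin n → F)} {b y : Fin n → F}
    (hy : y ∈ D) (hby : b ⬝ᵥ y ≠ 0) : ∃ z ∈ D, phase p b z ≠ 1 := by
  have : Module.Finite (ZMod p) F := Module.Finite.of_finite
  obtain ⟨t, ht⟩ := Algebra.trace_surjective (ZMod p) F 1
  refine ⟨(t / b ⬝ᵥ y) • y, D.smul_mem _ hy, ?_⟩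
  rw [phase_eq_stdAddChar_trace_dotProduct, dotProduct_smul, smul_eq_mul, div_mul_cancel₀ t hby,
    ht, ← AddChar.map_zero_eq_one (ZMod.stdAddChar (N := p))]
  exact ZMod.injective_stdAddChar.ne one_ne_zero

end Phase

section Weight

variable {F : Type*} [Field F] [DecidableEq F] {n : ℕ}

theorem hammingNorm_left_le_qWeight (a b : Fin n → F) : hammingNorm a ≤ qWeight a b :=
  Finset.card_le_card (Finset.monotone_filter_right _ fun _ _ h h0 => h (congrArg Prod.fst h0))

theorem hammingNorm_right_le_qWeight (a b : Fin n → F) : hammingNorm b ≤ qWeight a b :=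
  Finset.card_le_card (Finset.monotone_filter_right _ fun _ _ h h0 => h (congrArg Prod.snd h0))

theorem qWeight_zero_right (a : Fin n → F) : qWeight a 0 = hammingNorm a := by
  simp [qWeight, hammingNorm]

theorem qWeight_eq_zero_iff {a b : Fin n → F} : qWeight a b = 0 ↔ a = 0 ∧ b = 0 := by
  simp [qWeight, funext_iff, forall_and]

end Weight

section ErrorOperators

variable {F : Type*} [Field F] [Fintype F] {n : ℕ}

@[simp]
theorem opX_apply (a : Fin n → F) (ψ : QSpace F n) (x : Fin n → F) : opX a ψ x = ψ (x - a) :=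
  rfl

theorem opX_zero (ψ : QSpace F n) : opX 0 ψ = ψ := by
  ext x
  simp

theorem opX_comm (a b : Fin n → F) (ψ : QSpace F n) : opX a (opX b ψ) = opX b (opX a ψ) := by
  ext x
  simp [sub_right_comm]

theorem inner_opX_opX (a : Fin n → F) (u v : QSpace F n) :
    inner ℂ (opX a u) (opX a v) = inner ℂ u v := by
  simp only [PiLp.inner_apply, opX_apply]
  exact Equiv.sum_comp (Equiv.subRight a) fun x => inner ℂ (u x) (v x)

variable {p : ℕ} [Fact p.Prime] [Algebra (ZMod p) F]

theorem errorOp_apply (c : ZMod p) (a b : Fin n → F) (ψ : QSpace F n) (x : Fin n → F) :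
    errorOp c a b ψ x = ZMod.stdAddChar c * (phase p b (x - a) * ψ (x - a)) :=
  rfl

theorem errorOp_zero_right (c : ZMod p) (a : Fin n → F) (ψ : QSpace F n) :
    errorOp c a 0 ψ = ZMod.stdAddChar c • opX a ψ := by
  ext x
  simp [errorOp_apply]

theorem errorOp_opX (c : ZMod p) (a b z : Fin n → F) (ψ : QSpace F n) :
    errorOp c a b (opX z ψ) = phase p b z • opX z (errorOp c a b ψ) := by
  ext x
  have hphase : phase p b (x - a) = phase p b z * phase p b (x - z - a) := by
    rw [← phase_add, sub_right_comm, add_sub_cancel]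
  simp only [errorOp_apply, opX_apply, PiLp.smul_apply, smul_eq_mul, hphase, sub_right_comm x a z]
  ring

theorem inner_errorOp_eq_zero_of_opX_eq {u v : QSpace F n} {b z : Fin n → F} (hu : opX z u = u)
    (hv : opX z v = v) (hbz : phase p b z ≠ 1) (c : ZMod p) (a : Fin n → F) :
    inner ℂ u (errorOp c a b v) = 0 := by
  have h : inner ℂ u (errorOp c a b v) = phase p b z * inner ℂ u (errorOp c a b v) :=
    calc inner ℂ u (errorOp c a b v)
        = inner ℂ (opX z u) (errorOp c a b (opX z v)) := by rw [hu, hv]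
      _ = phase p b z * inner ℂ u (errorOp c a b v) := by
          rw [errorOp_opX, inner_smul_right, inner_opX_opX]
  exact (mul_left_eq_self₀.mp h.symm).resolve_left hbz

theorem Pure.detects [DecidableEq F] {Q : Submodule ℂ (QSpace F n)} {t : ℕ} (hQ : Pure p Q t) :
    Detects p Q t := by
  intro u hu v hv huv c a b hab
  rcases Nat.eq_zero_or_pos (qWeight a b) with h0 | hpos
  · obtain ⟨rfl, rfl⟩ := qWeight_eq_zero_iff.mp h0
    rw [errorOp_zero_right, opX_zero, inner_smul_right, huv, mul_zero]
  · exact hQ u hu v hv c a b hpos hab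

end ErrorOperators

section CSS

variable {F : Type*} [Field F] [Fintype F] {n : ℕ} {C D : Submodule F (Fin n → F)}

/-- The Calderbank–Shor–Steane code of linear codes `D ≤ C`: the states supported on `C` that are
stabilized by `X(z)` for all `z ∈ D`, i.e. constant on the cosets of `D`. -/
def cssCode (C D : Submodule F (Fin n → F)) : Submodule ℂ (QSpace F n) where
  carrier := {ψ | (∀ x ∉ C, ψ x = 0) ∧ ∀ z ∈ D, opX z ψ = ψ}
  zero_mem' := ⟨fun _ _ => rfl, fun _ _ => map_zero _⟩
  add_mem' hψ hφ :=
    ⟨fun x hx => by rw [PiLp.add_apply, hψ.1 x hx, hφ.1 x hx, add_zero],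
      fun z hz => by rw [map_add, hψ.2 z hz, hφ.2 z hz]⟩
  smul_mem' r ψ hψ :=
    ⟨fun x hx => by rw [PiLp.smul_apply, hψ.1 x hx, smul_zero],
      fun z hz => by rw [map_smul, hψ.2 z hz]⟩

theorem mem_cssCode {ψ : QSpace F n} :
    ψ ∈ cssCode C D ↔ (∀ x ∉ C, ψ x = 0) ∧ ∀ z ∈ D, opX z ψ = ψ :=
  Iff.rfl

/-- The encoder of a CSS code: a function on `C ⧸ D` is pulled back to `C` and extended by zero. -/
noncomputable def cssEncoder (C D : Submodule F (Fin n → F)) :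
    (C ⧸ D.submoduleOf C → ℂ) →ₗ[ℂ] QSpace F n :=
  (WithLp.linearEquiv 2 ℂ ((Fin n → F) → ℂ)).symm.toLinearMap ∘ₗ
    Function.ExtendByZero.linearMap ℂ ((↑) : C → Fin n → F) ∘ₗ
    LinearMap.funLeft ℂ ℂ (D.submoduleOf C).mkQ

theorem cssEncoder_injective (C D : Submodule F (Fin n → F)) :
    Function.Injective (cssEncoder C D) :=
  (WithLp.linearEquiv 2 ℂ ((Fin n → F) → ℂ)).symm.injective.comp <|
    (Function.extend_injective Subtype.val_injective (0 : (Fin n → F) → ℂ)).comp <|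
    LinearMap.funLeft_injective_of_surjective ℂ ℂ _ (D.submoduleOf C).mkQ_surjective

theorem cssEncoder_apply_coe (g : C ⧸ D.submoduleOf C → ℂ) (x : C) :
    cssEncoder C D g x = g ((D.submoduleOf C).mkQ x) :=
  Subtype.val_injective.extend_apply _ _ x

theorem cssEncoder_apply_of_notMem (g : C ⧸ D.submoduleOf C → ℂ) {x : Fin n → F} (hx : x ∉ C) :
    cssEncoder C D g x = 0 :=
  Function.extend_apply' _ _ _ fun ⟨y, hy⟩ => hx (hy ▸ y.2)

theorem cssEncoder_mem_cssCode (h : D ≤ C) (g : C ⧸ D.submoduleOf C → ℂ) :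
    cssEncoder C D g ∈ cssCode C D := by
  refine mem_cssCode.2 ⟨fun x hx => cssEncoder_apply_of_notMem g hx, fun z hz => ?_⟩
  ext x
  rw [opX_apply]
  by_cases hx : x ∈ C
  · lift x to C using hx
    have hzero : (D.submoduleOf C).mkQ ⟨z, h hz⟩ = 0 := (Submodule.Quotient.mk_eq_zero _).2 hz
    rw [← C.coe_sub x ⟨z, h hz⟩, cssEncoder_apply_coe, cssEncoder_apply_coe, map_sub, hzero,
      sub_zero]
  · have hxz : x - z ∉ C := mt (C.sub_mem_iff_left (h hz)).1 hx
    rw [cssEncoder_apply_of_notMem g hx, cssEncoder_apply_of_notMem g hxz]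

theorem factorsThrough_mkQ_of_mem_cssCode {ψ : QSpace F n} (hψ : ψ ∈ cssCode C D) :
    Function.FactorsThrough (fun x : C => ψ x) (D.submoduleOf C).mkQ := by
  intro x y hxy
  have hyx : (y - x : Fin n → F) ∈ D := (Submodule.Quotient.eq (D.submoduleOf C)).1 hxy.symm
  simpa using PiLp.ext_iff.1 (hψ.2 _ hyx) y

theorem range_cssEncoder (h : D ≤ C) : LinearMap.range (cssEncoder C D) = cssCode C D := by
  refine le_antisymm ?_ fun ψ hψ => ?_
  · rintro _ ⟨g, rfl⟩
    exact cssEncoder_mem_cssCode h g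
  · refine ⟨Function.extend (D.submoduleOf C).mkQ (fun x : C => ψ x) 0, ?_⟩
    ext x
    by_cases hx : x ∈ C
    · lift x to C using hx
      rw [cssEncoder_apply_coe, (factorsThrough_mkQ_of_mem_cssCode hψ).extend_apply]
    · rw [cssEncoder_apply_of_notMem _ hx, hψ.1 x hx]

theorem finrank_cssCode (h : D ≤ C) :
    Module.finrank ℂ (cssCode C D) =
      Fintype.card F ^ (Module.finrank F C - Module.finrank F D) := by
  classical
  have : Fintype (C ⧸ D.submoduleOf C) := Fintype.ofFinite _
  rw [← range_cssEncoder h, LinearMap.finrank_range_of_inj (cssEncoder_injective C D),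
    Module.finrank_fintype_fun_eq_card, Module.card_eq_pow_finrank (K := F),
    Submodule.finrank_quotient, (Submodule.submoduleOfEquivOfLe h).finrank_eq]

theorem opX_mem_cssCode {a : Fin n → F} (ha : a ∈ C) {ψ : QSpace F n} (hψ : ψ ∈ cssCode C D) :
    opX a ψ ∈ cssCode C D :=
  mem_cssCode.2 ⟨fun x hx => hψ.1 _ (mt (C.sub_mem_iff_left ha).1 hx),
    fun z hz => by rw [opX_comm, hψ.2 z hz]⟩

/-- The unnormalized state `∑_{y ∈ D} |y⟩`, which lies in every CSS code `cssCode C D` and whose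
translates by `X(a)`, `a ∈ C`, witness undetected errors. -/
noncomputable def codeState (D : Submodule F (Fin n → F)) : QSpace F n :=
  WithLp.toLp 2 ((D : Set (Fin n → F)).indicator 1)

theorem codeState_ne_zero (D : Submodule F (Fin n → F)) : codeState D ≠ 0 := by
  intro h
  simpa [codeState] using PiLp.ext_iff.1 h 0

theorem codeState_mem_cssCode (h : D ≤ C) : codeState D ∈ cssCode C D := by
  refine mem_cssCode.2
    ⟨fun x hx => Set.indicator_of_notMem (fun hxD => hx (h hxD)) _, fun z hz => ?_⟩
  ext x
  classical exact if_congr (D.sub_mem_iff_left hz) rfl rfl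

theorem inner_opX_codeState_self {a : Fin n → F} (ha : a ∉ D) :
    inner ℂ (opX a (codeState D)) (codeState D) = 0 := by
  rw [PiLp.inner_apply]
  refine Finset.sum_eq_zero fun x _ => ?_
  by_cases hx : x ∈ D
  · have hxa : x - a ∉ D := mt (D.sub_mem_iff_right hx).1 ha
    simp [codeState, hxa]
  · simp [codeState, hx]

variable {p : ℕ} [Fact p.Prime] [Algebra (ZMod p) F]

theorem inner_errorOp_eq_zero_of_notMem {u v : QSpace F n} (hu : u ∈ cssCode C D)
    (hv : v ∈ cssCode C D) {a : Fin n → F} (ha : a ∉ C) (c : ZMod p) (b : Fin n → F) :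
    inner ℂ u (errorOp c a b v) = 0 := by
  rw [PiLp.inner_apply]
  refine Finset.sum_eq_zero fun x _ => ?_
  by_cases hx : x ∈ C
  · rw [errorOp_apply, hv.1 _ (mt (C.sub_mem_iff_right hx).1 ha), mul_zero, mul_zero,
      inner_zero_right]
  · rw [hu.1 x hx, inner_zero_left]

variable [DecidableEq F]

theorem pure_cssCode {t : ℕ} (hC : ∀ a ∈ C, a ≠ 0 → t < hammingNorm a)
    (hD : ∀ b ≠ 0, (∀ y ∈ D, b ⬝ᵥ y = 0) → t < hammingNorm b) : Pure p (cssCode C D) t := by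
  intro u hu v hv c a b hpos hab
  by_cases haC : a ∈ C
  swap; · exact inner_errorOp_eq_zero_of_notMem hu hv haC c b
  have ha : a = 0 := by
    by_contra ha
    exact ((hC a haC ha).trans_le (hammingNorm_left_le_qWeight a b)).not_ge hab
  have hb : b ≠ 0 := fun hb => (Nat.one_le_iff_ne_zero.1 hpos) (qWeight_eq_zero_iff.2 ⟨ha, hb⟩)
  obtain ⟨y, hy, hby⟩ : ∃ y ∈ D, b ⬝ᵥ y ≠ 0 := by
    by_contra! hbD
    exact ((hD b hb hbD).trans_le (hammingNorm_right_le_qWeight a b)).not_ge hab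
  obtain ⟨z, hz, hbz⟩ := exists_mem_phase_ne_one p hy hby
  exact inner_errorOp_eq_zero_of_opX_eq (hu.2 z hz) (hv.2 z hz) hbz c a

theorem isCode_cssCode (h : D ≤ C) {t : ℕ} (hC : ∀ a ∈ C, a ≠ 0 → t < hammingNorm a)
    (hD : ∀ b ≠ 0, (∀ y ∈ D, b ⬝ᵥ y = 0) → t < hammingNorm b) :
    IsCode p (cssCode C D) (Module.finrank F C - Module.finrank F D) (t + 1) where
  finrank_eq := finrank_cssCode h
  one_le := Nat.le_add_left 1 t
  detects := (pure_cssCode hC hD).detects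
  pure_of_finrank_eq_one _ := pure_cssCode hC hD

theorem IsCode.le_hammingNorm (h : D ≤ C) {a : Fin n → F} (haC : a ∈ C) (ha0 : a ≠ 0)
    (haD : D = C ∨ a ∉ D) {k d : ℕ} (hQ : IsCode p (cssCode C D) k d) : d ≤ hammingNorm a := by
  by_contra! hd
  have hmem : codeState D ∈ cssCode C D := codeState_mem_cssCode h
  have hwt : qWeight a 0 ≤ d - 1 := by rw [qWeight_zero_right]; omega
  have hzero : inner ℂ (opX a (codeState D)) (errorOp (0 : ZMod p) a 0 (codeState D)) = 0 := by
    rcases haD with rfl | haD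
    · refine hQ.pure_of_finrank_eq_one ?_ _ (opX_mem_cssCode haC hmem) _ hmem 0 a 0 ?_ hwt
      · rw [finrank_cssCode le_rfl, Nat.sub_self, pow_zero]
      · rw [qWeight_zero_right]
        exact hammingNorm_pos_iff.2 ha0
    · exact hQ.detects _ (opX_mem_cssCode haC hmem) _ hmem (inner_opX_codeState_self haD) 0 a 0 hwt
  rw [errorOp_zero_right, AddChar.map_zero_eq_one, one_smul, inner_opX_opX] at hzero
  exact codeState_ne_zero D (inner_self_eq_zero.1 hzero)

end CSS

section ReedSolomon

open Polynomial Lagrange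

variable {R ι : Type*} [CommRing R]

/-- Evaluation of polynomials at the points `α i`. -/
noncomputable def evalPoints (α : ι → R) : R[X] →ₗ[R] (ι → R) :=
  LinearMap.pi fun i => leval (α i)

@[simp]
theorem evalPoints_apply (α : ι → R) (f : R[X]) (i : ι) : evalPoints α f i = f.eval (α i) :=
  rfl

/-- The Reed–Solomon code `RS_k`: the evaluations at the points `α i` of the
polynomials of degree less than `k`. -/
noncomputable def reedSolomon (α : ι → R) (k : ℕ) : Submodule R (ι → R) :=
  (degreeLT R k).map (evalPoints α)

theorem reedSolomon_mono (α : ι → R) : Monotone (reedSolomon α) :=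
  fun _ _ h => Submodule.map_mono (degreeLT_mono h)

variable {α : ι → R} {k : ℕ}

theorem nodal_mem_degreeLT [Nontrivial R] {s : Finset ι} (hs : s.card < k) :
    nodal s α ∈ degreeLT R k := by
  rw [mem_degreeLT, degree_nodal]
  exact_mod_cast hs

variable [IsDomain R]

theorem evalPoints_nodal_eq_zero_iff (hα : Function.Injective α) {s : Finset ι} {i : ι} :
    evalPoints α (nodal s α) i = 0 ↔ i ∈ s := by
  simp [eval_nodal, Finset.prod_eq_zero_iff, sub_eq_zero, hα.eq_iff]

variable [Fintype ι]

theorem finrank_reedSolomon (hα : Function.Injective α) (hk : k ≤ Fintype.card ι) :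
    Module.finrank R (reedSolomon α k) = k := by
  have hinj : Function.Injective ((evalPoints α).domRestrict (degreeLT R k)) := by
    refine (injective_iff_map_eq_zero _).2 fun f hf => Subtype.ext ?_
    refine eq_zero_of_degree_lt_of_eval_index_eq_zero Finset.univ hα.injOn ?_
      fun i _ => congrFun hf i
    exact (mem_degreeLT.1 f.2).trans_le (by exact_mod_cast hk)
  rw [reedSolomon, ← LinearMap.range_domRestrict, LinearMap.finrank_range_of_inj hinj,
    (degreeLTEquiv R k).finrank_eq, Module.finrank_fin_fun]

variable [DecidableEq R]

theorem card_lt_add_hammingNorm_of_mem_reedSolomon (hα : Function.Injective α) {a : ι → R}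
    (ha : a ∈ reedSolomon α k) (ha0 : a ≠ 0) : Fintype.card ι < k + hammingNorm a := by
  obtain ⟨f, hf, rfl⟩ := ha
  set zeros : Finset ι := Finset.univ.filter fun i => evalPoints α f i = 0
  have hcard : zeros.card + hammingNorm (evalPoints α f) = Fintype.card ι :=
    Finset.card_filter_add_card_filter_not _
  have hf0 : f ≠ 0 := by
    rintro rfl
    exact ha0 (map_zero _)
  by_contra! hle
  have hdeg : f.degree < zeros.card :=
    (mem_degreeLT.1 hf).trans_le (Nat.cast_le.2 (by omega))
  exact hf0 <| eq_zero_of_degree_lt_of_eval_index_eq_zero zeros hα.injOn hdeg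
    fun i hi => (Finset.mem_filter.1 hi).2

theorem lt_hammingNorm_of_orthogonal_reedSolomon (hα : Function.Injective α) {b : ι → R}
    (hb0 : b ≠ 0) (hb : ∀ y ∈ reedSolomon α k, b ⬝ᵥ y = 0) : k < hammingNorm b := by
  classical
  by_contra! hle
  obtain ⟨i, hi⟩ := Function.ne_iff.1 hb0
  set s : Finset ι := Finset.univ.filter fun j => b j ≠ 0
  have hcard : (s.erase i).card < k :=
    (Finset.card_erase_lt_of_mem (Finset.mem_filter.2 ⟨Finset.mem_univ i, hi⟩)).trans_le hle
  -- The word vanishing exactly on the support of `b` minus `i` isolates the coordinate `b i`.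
  have h := hb _ ⟨_, nodal_mem_degreeLT (α := α) hcard, rfl⟩
  rw [dotProduct, Finset.sum_eq_single i] at h
  · have hmem := (evalPoints_nodal_eq_zero_iff hα).1 ((mul_eq_zero.1 h).resolve_left hi)
    exact Finset.notMem_erase i s hmem
  · intro j _ hji
    by_cases hbj : b j = 0
    · rw [hbj, zero_mul]
    · rw [(evalPoints_nodal_eq_zero_iff hα).2, mul_zero]
      exact Finset.mem_erase.2 ⟨hji, Finset.mem_filter.2 ⟨Finset.mem_univ j, hbj⟩⟩
  · exact fun h => absurd (Finset.mem_univ i) h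

theorem exists_mem_reedSolomon_add_hammingNorm_eq (hα : Function.Injective α)
    (hk : k ≤ Fintype.card ι) :
    ∃ a ∈ reedSolomon α (k + 1), k + hammingNorm a = Fintype.card ι := by
  classical
  obtain ⟨s, -, rfl⟩ := Finset.exists_subset_card_eq (s := (Finset.univ : Finset ι)) hk
  refine ⟨_, ⟨nodal s α, nodal_mem_degreeLT s.card.lt_succ_self, rfl⟩, ?_⟩
  rw [← Finset.card_add_card_compl s, hammingNorm]
  congr 2
  ext i
  simp only [Finset.mem_filter, Finset.mem_univ, true_and, Finset.mem_compl, ne_eq,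
    evalPoints_nodal_eq_zero_iff hα]

end ReedSolomon

section ReedSolomonCSS

variable {p : ℕ} [Fact p.Prime] {F : Type*} [Field F] [Fintype F] [DecidableEq F]
  [Algebra (ZMod p) F] {n k₁ k₂ : ℕ} {α : Fin n → F}

theorem isCode_cssCode_reedSolomon (hα : Function.Injective α) (hk₁n : k₁ ≤ n) (hk₂n : k₂ ≤ n)
    (hk : n ≤ k₁ + k₂) :
    IsCode p (cssCode (reedSolomon α k₁) (reedSolomon α (n - k₂))) (k₁ + k₂ - n)
      (min (n - k₁) (n - k₂) + 1) := by
  have hdim : k₁ + k₂ - n = Module.finrank F (reedSolomon α k₁) -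
      Module.finrank F (reedSolomon α (n - k₂)) := by
    rw [finrank_reedSolomon hα (by simpa using hk₁n), finrank_reedSolomon hα (by simp)]
    omega
  rw [hdim]
  refine isCode_cssCode (reedSolomon_mono α (by omega)) (fun a ha ha0 => ?_) fun b hb0 hb => ?_
  · have := card_lt_add_hammingNorm_of_mem_reedSolomon hα ha ha0
    rw [Fintype.card_fin] at this
    omega
  · exact (min_le_right _ _).trans_lt (lt_hammingNorm_of_orthogonal_reedSolomon hα hb0 hb)

theorem IsCode.le_of_cssCode_reedSolomon (hα : Function.Injective α) (hk₁ : 1 ≤ k₁)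
    (hk₁n : k₁ ≤ n) (hk : n ≤ k₁ + k₂) {k d : ℕ}
    (hQ : IsCode p (cssCode (reedSolomon α k₁) (reedSolomon α (n - k₂))) k d) :
    d ≤ n - k₁ + 1 := by
  obtain ⟨l, rfl⟩ := Nat.exists_eq_add_of_le' hk₁
  obtain ⟨a, haC, hwt⟩ := exists_mem_reedSolomon_add_hammingNorm_eq (k := l) hα
    (by rw [Fintype.card_fin]; omega)
  rw [Fintype.card_fin] at hwt
  have ha0 : a ≠ 0 := hammingNorm_pos_iff.1 (by omega)
  have hle : n - k₂ ≤ l + 1 := by omega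
  have haD : reedSolomon α (n - k₂) = reedSolomon α (l + 1) ∨ a ∉ reedSolomon α (n - k₂) := by
    refine hle.eq_or_lt.imp (congrArg _) fun hlt ha => ?_
    have := card_lt_add_hammingNorm_of_mem_reedSolomon hα ha ha0
    rw [Fintype.card_fin] at this
    omega
  have := hQ.le_hammingNorm (reedSolomon_mono α hle) haC ha0 haD
  omega

theorem exists_hasParameters_min (hn0 : 0 < n) (hn : n ≤ Fintype.card F) (hk₁n : k₁ ≤ n)
    (hk₂n : k₂ ≤ n) (hk : n ≤ k₁ + k₂) :
    ∃ Q : Submodule ℂ (QSpace F n),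
      HasParameters p Q (k₁ + k₂ - n) (min (n - k₁) (n - k₂) + 1) := by
  -- The parameters are symmetric in `k₁` and `k₂`, so we may let the `X`-distance be the minimum.
  wlog hle : k₂ ≤ k₁ generalizing k₁ k₂
  · rw [add_comm k₁, min_comm]
    exact this hk₂n hk₁n (by omega) (by omega)
  obtain ⟨α⟩ : Nonempty (Fin n ↪ F) := Function.Embedding.nonempty_of_card_le (by simpa using hn)
  refine ⟨_, isCode_cssCode_reedSolomon α.injective hk₁n hk₂n hk, fun d hd => ?_⟩
  rw [min_eq_left (by omega)]
  exact IsCode.le_of_cssCode_reedSolomon α.injective (by omega) hk₁n hk hd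

end ReedSolomonCSS

end QuantumCode

theorem theorem3p7 {p : ℕ} [Fact p.Prime] {F : Type*} [Field F] [Fintype F] [DecidableEq F]
    [Algebra (ZMod p) F] (n k₁ k₂ : ℕ) (hn : n ≤ Fintype.card F)
    (hk₁ : 1 ≤ k₁) (hk₁n : k₁ ≤ n) (hk₂ : 1 ≤ k₂) (hk₂n : k₂ ≤ n) (hk : n ≤ k₁ + k₂) :
    (∃ (Q : Submodule ℂ (QuantumCode.QSpace F n)) (d : ℕ),
      QuantumCode.HasParameters p Q (k₁ + k₂ - n) d ∧ min (n - k₁ + 1) (n - k₂ + 1) ≤ d) ∧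
    (∀ k : ℕ, k₁ = k → k₂ = k → ⌈(n : ℚ) / 2⌉₊ ≤ k →
      ∃ Q : Submodule ℂ (QuantumCode.QSpace F n),
        QuantumCode.IsQuantumMDS p Q (2 * k - n) (n - k + 1)) := by
  have hn0 : 0 < n := hk₁.trans hk₁n
  refine ⟨?_, ?_⟩
  · obtain ⟨Q, hQ⟩ := QuantumCode.exists_hasParameters_min (p := p) hn0 hn hk₁n hk₂n hk
    exact ⟨Q, _, hQ, (min_add_add_right _ _ 1).le⟩
  · rintro k rfl rfl -
    obtain ⟨Q, hQ⟩ := QuantumCode.exists_hasParameters_min (p := p) hn0 hn hk₁n hk₁n hk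
    rw [min_self, ← two_mul] at hQ
    refine ⟨Q, hQ, ?_⟩
    omega
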